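/- Let $C_m=\frac{1}{m+1}\binom{2m}{m}$ denote the $m$-th Catalan number. Consider a convex $n$-gon with labelled vertices. A triangulation of it is a set of $n-3$ pairwise noncrossing diagonals; it is viewed as a graph on the $n$ vertices whose edges are the $n$ sides of the polygon together with these diagonals. A cycle of length $k$ in a triangulation is a subgraph of this graph that is a cycle on $k$ vertices. Let $3\le k<n$. Then the average number of cycles of length $k$ in a triangulation of the $n$-gon, taken over all triangulations with equal weight, is $$\binom{2n-k-1}{n-1}\,\frac{C_{k-2}}{C_{n-2}}.$$ -/

import Mathlib

/-!
Dissections of a convex `n`-gon. The vertices of the polygon are labelled `0, 1, …, n - 1` (the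
elements of `Fin n`) in cyclic order along the boundary, so that its sides are the edges of
`SimpleGraph.cycleGraph n`.
-/

namespace PolygonDissection

/-- A diagonal of the `n`-gon: an unordered pair of distinct vertices that is not a side. -/
def IsDiagonal {n : ℕ} (e : Sym2 (Fin n)) : Prop :=
  ¬ e.IsDiag ∧ e ∉ (SimpleGraph.cycleGraph n).edgeSet

/-- Two chords of a convex polygon cross (meet in a point interior to both) if and only if their
end points are four distinct vertices that alternate along the boundary. -/
def Cross {n : ℕ} (e f : Sym2 (Fin n)) : Prop :=
  ∃ a b c d : Fin n, a < b ∧ b < c ∧ c < d ∧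
    ((e = s(a, c) ∧ f = s(b, d)) ∨ (e = s(b, d) ∧ f = s(a, c)))

/-- A `k`-dissection of the `n`-gon, given by its `k` pairwise noncrossing diagonals. -/
def IsDissection {n : ℕ} (k : ℕ) (D : Finset (Sym2 (Fin n))) : Prop :=
  D.card = k ∧ (∀ e ∈ D, IsDiagonal e) ∧ ∀ e ∈ D, ∀ f ∈ D, ¬ Cross e f

/-- A triangulation of the `n`-gon (`3 ≤ n`) is an `(n - 3)`-dissection. -/
def IsTriangulation {n : ℕ} (D : Finset (Sym2 (Fin n))) : Prop :=
  IsDissection (n - 3) D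

open Classical in
/-- The finite set of all triangulations of the `n`-gon with labelled vertices. -/
noncomputable def triangulations (n : ℕ) : Finset (Finset (Sym2 (Fin n))) :=
  Finset.univ.filter IsTriangulation

/-- The graph drawn by a dissection: its edges are the sides of the polygon and the chosen
diagonals. -/
def graph {n : ℕ} (D : Finset (Sym2 (Fin n))) : SimpleGraph (Fin n) :=
  SimpleGraph.cycleGraph n ⊔ SimpleGraph.fromEdgeSet (D : Set (Sym2 (Fin n)))

/-- The number of cycles of length `k` (`3 ≤ k`) in a graph `G`: the number of subgraphs of `G`
that are isomorphic to the cycle graph on `k` vertices. -/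
noncomputable def numCycles {V : Type*} [Fintype V] (G : SimpleGraph V) (k : ℕ) : ℕ :=
  G.copyCount (SimpleGraph.cycleGraph k)

/-- The average number of cycles of length `k`, taken over all triangulations of the `n`-gon. -/
noncomputable def averageCycles (n k : ℕ) : ℚ :=
  (∑ D ∈ triangulations n, (numCycles (graph D) k : ℚ)) / ((triangulations n).card : ℚ)

end PolygonDissection

/-! Cutting along the triangle on the base edge makes triangulations of the `n`-gon correspond to
binary trees with `n - 2` nodes, of which there are `catalan (n - 2)`. It remains to sum the number
of `k`-cycles over these trees.

In a noncrossing graph every cycle runs through its vertices in their cyclic order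
(`subgraph_adj_iff`), so a cycle is determined by its vertex set. At a node, such a set either lies
in one of the two subpolygons, or is a monotone path through the apex closed up by the base edge
(`mem_cycleSets`).

Let `c` be the Catalan series. Monotone paths with `l + 1` edges between the ends of the base edge
are either the base edge itself or two shorter paths joined at the apex, so the Catalan recurrence
gives them the generating function `catalan l * X ^ l * c ^ (l + 1)` (`treeGF_pathCount_succ`). For
`l ≥ 1`, the series `Z` of cycles with `l + 2` edges satisfies `Z = 2 X c Z` plus this path series.
Since `c ^ r / (1 - 2 X c)` is the series with coefficients `(2m + r).choose m` (`chooseGF_mul`),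
comparing coefficients yields the formula. -/

namespace PolygonDissection

/-! ### Generating functions of paths and cycles over binary trees -/

open PowerSeries Finset BinaryTree

/-- The generating function of the Catalan numbers, with rational coefficients. -/
noncomputable def catalanGF : ℚ⟦X⟧ := mk fun m => (catalan m : ℚ)

theorem catalanGF_eq : catalanGF = 1 + X * catalanGF ^ 2 := by
  have h := congrArg (PowerSeries.map (Nat.castRingHom ℚ)) catalanSeries_sq_mul_X_add_one
  have hc : PowerSeries.map (Nat.castRingHom ℚ) catalanSeries = catalanGF := by
    ext m
    simp [catalanGF]
  simp only [map_add, map_mul, map_pow, map_one, map_X, hc] at h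
  linear_combination -h

theorem two_ne_zero_powerSeries : (2 : ℚ⟦X⟧) ≠ 0 := by
  intro h
  have := congrArg constantCoeff h
  rw [map_ofNat, map_zero] at this
  norm_num at this

/-- The generating function `∑ (2m + r choose m) X ^ m`. -/
noncomputable def chooseGF (r : ℕ) : ℚ⟦X⟧ := mk fun m => ((2 * m + r).choose m : ℚ)

theorem chooseGF_succ (r : ℕ) : chooseGF (r + 1) = chooseGF r + X * chooseGF (r + 2) := by
  ext m
  cases m with
  | zero => simp [chooseGF]
  | succ m =>
    rw [map_add, coeff_succ_X_mul]
    simp only [chooseGF, coeff_mk]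
    rw [show 2 * (m + 1) + (r + 1) = (2 * m + r + 2) + 1 by ring, Nat.choose_succ_succ,
      show 2 * (m + 1) + r = 2 * m + r + 2 by ring, show 2 * m + (r + 2) = 2 * m + r + 2 by ring]
    push_cast
    ring

theorem chooseGF_zero_eq : chooseGF 0 = 1 + 2 * (X * chooseGF 1) := by
  ext m
  cases m with
  | zero => simp [chooseGF]
  | succ m =>
    rw [map_add, show (2 : ℚ⟦X⟧) = C (2 : ℚ) from (map_ofNat C 2).symm, coeff_C_mul, coeff_succ_X_mul, coeff_one]
    simp only [chooseGF, coeff_mk]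
    rw [show 2 * (m + 1) + 0 = (2 * m + 1) + 1 by ring, Nat.choose_succ_succ,
      ← Nat.choose_symm_half m]
    simp
    ring

/-- This is the recurrence `(m + 1) * centralBinom (m + 1) = 2 * (2m + 1) * centralBinom m`, read
coefficientwise. -/
theorem derivative_chooseGF_zero :
    (1 - 4 * X) * derivative ℚ (chooseGF 0) = 2 * chooseGF 0 := by
  have key : ∀ m : ℕ, ((m : ℚ) + 1) * Nat.centralBinom (m + 1)
      = 2 * (2 * m + 1) * Nat.centralBinom m := fun m => by
    exact_mod_cast Nat.succ_mul_centralBinom_succ m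
  have hc : chooseGF 0 = mk fun m => (Nat.centralBinom m : ℚ) := rfl
  rw [hc, show (1 - 4 * X : ℚ⟦X⟧) = 1 - C (4 : ℚ) * X by rw [map_ofNat],
    show (2 : ℚ⟦X⟧) = C (2 : ℚ) from (map_ofNat C 2).symm]
  ext m
  rw [sub_mul, one_mul, mul_assoc, map_sub, coeff_C_mul, coeff_C_mul, coeff_derivative]
  cases m with
  | zero => simp [Nat.centralBinom]
  | succ m =>
    rw [coeff_succ_X_mul, coeff_derivative]
    simp only [coeff_mk]
    have := key (m + 1)
    push_cast at this ⊢
    linear_combination this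

/-- The factor `D = 1 - 2 X c` is a square root of `1 - 4 X`, and `chooseGF 0` satisfies the
differential equation of its inverse. Hence the product has derivative zero and constant term one.
-/
theorem chooseGF_zero_mul : chooseGF 0 * (1 - 2 * X * catalanGF) = 1 := by
  set D : ℚ⟦X⟧ := 1 - 2 * X * catalanGF with hD
  have hsq : D ^ 2 = 1 - 4 * X := by
    rw [hD]
    linear_combination (-4 * X) * catalanGF_eq
  have hd : D * derivative ℚ D = -2 := by
    have h := congrArg (derivative ℚ) hsq
    have h4 : derivative ℚ (4 : ℚ⟦X⟧) = 0 := by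
      rw [show (4 : ℚ⟦X⟧) = C (4 : ℚ) from (map_ofNat C 4).symm, derivative_C]
    have hr : derivative ℚ (1 - 4 * X : ℚ⟦X⟧) = -4 := by
      rw [map_sub, Derivation.leibniz, derivative_one, derivative_X, h4]
      simp
    rw [sq, Derivation.leibniz, hr] at h
    simp only [smul_eq_mul] at h
    apply mul_left_cancel₀ two_ne_zero_powerSeries
    linear_combination h
  have hne : (1 - 4 * X : ℚ⟦X⟧) ≠ 0 := by
    intro h
    have := congrArg constantCoeff h
    simp at this
  apply derivative.ext (R := ℚ)
  · apply mul_left_cancel₀ hne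
    rw [Derivation.leibniz, derivative_one, smul_eq_mul, smul_eq_mul]
    linear_combination D * derivative_chooseGF_zero + chooseGF 0 * D * hd
      - chooseGF 0 * derivative ℚ D * hsq
  · rw [hD]
    have h0 : constantCoeff (chooseGF 0) = 1 := by
      rw [← coeff_zero_eq_constantCoeff_apply]
      simp [chooseGF]
    simp [h0]

/-- Both sides satisfy `a (r + 1) = a r + X * a (r + 2)`: on the left by Pascal's rule, on the right
by the quadratic equation of the Catalan series. Two consecutive cases are therefore carried through
the induction. -/
theorem chooseGF_mul (r : ℕ) : chooseGF r * (1 - 2 * X * catalanGF) = catalanGF ^ r := by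
  suffices h : chooseGF r * (1 - 2 * X * catalanGF) = catalanGF ^ r ∧
      chooseGF (r + 1) * (1 - 2 * X * catalanGF) = catalanGF ^ (r + 1) from h.1
  have hX : (X : ℚ⟦X⟧) ≠ 0 := X_ne_zero
  induction r with
  | zero =>
    refine ⟨by simpa using chooseGF_zero_mul, ?_⟩
    apply mul_left_cancel₀ (mul_ne_zero two_ne_zero_powerSeries hX)
    linear_combination chooseGF_zero_mul - (1 - 2 * X * catalanGF) * chooseGF_zero_eq
  | succ r ih =>
    refine ⟨ih.2, ?_⟩
    apply mul_left_cancel₀ hX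
    linear_combination ih.2 - ih.1 - (1 - 2 * X * catalanGF) * chooseGF_succ r
      + catalanGF ^ r * catalanGF_eq

/-- The generating function, by number of nodes, of a weight on binary trees. -/
noncomputable def treeGF (f : BinaryTree Unit → ℚ) : ℚ⟦X⟧ :=
  mk fun m => ∑ t ∈ treesOfNumNodesEq m, f t

/-- The weight of a tree that is the product of the weights of its two subtrees. -/
def nodeWeight (g h : BinaryTree Unit → ℚ) : BinaryTree Unit → ℚ
  | nil => 0
  | node _ a b => g a * h b

theorem treeGF_add (f g : BinaryTree Unit → ℚ) : treeGF (f + g) = treeGF f + treeGF g := by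
  ext m
  simp [treeGF, sum_add_distrib]

theorem treeGF_sum {ι : Type*} (s : Finset ι) (f : ι → BinaryTree Unit → ℚ) :
    treeGF (∑ i ∈ s, f i) = ∑ i ∈ s, treeGF (f i) := by
  ext m
  simp only [treeGF, coeff_mk, map_sum, Finset.sum_apply]
  rw [sum_comm]

theorem treeGF_one : treeGF (fun _ => 1) = catalanGF := by
  ext m
  simp [treeGF, catalanGF, treesOfNumNodesEq_card_eq_catalan]

theorem treeGF_nodeWeight (g h : BinaryTree Unit → ℚ) :
    treeGF (nodeWeight g h) = X * (treeGF g * treeGF h) := by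
  ext m
  cases m with
  | zero => simp [treeGF, nodeWeight]
  | succ m =>
    rw [coeff_succ_X_mul, coeff_mul]
    simp only [treeGF, coeff_mk]
    rw [treesOfNumNodesEq_succ, sum_biUnion]
    · refine sum_congr rfl fun ij _ => ?_
      rw [sum_map, sum_product, sum_mul_sum]
      rfl
    · simp_rw [Set.PairwiseDisjoint, Set.Pairwise, disjoint_left]
      aesop

/-- The number of monotone paths with `l` edges that join the end points of the base edge of the
triangulation that belongs to a binary tree. -/
def pathCount : BinaryTree Unit → ℕ → ℕ
  | nil, l => if l = 1 then 1 else 0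
  | node _ a b, l =>
    (if l = 1 then 1 else 0) + ∑ p ∈ antidiagonal l, pathCount a p.1 * pathCount b p.2

/-- The number of cycles with `l + 1` edges in the triangulation that belongs to a binary tree. -/
def cycleCount : BinaryTree Unit → ℕ → ℕ
  | nil, _ => 0
  | node _ a b, l =>
    cycleCount a l + cycleCount b l + ∑ p ∈ antidiagonal l, pathCount a p.1 * pathCount b p.2

theorem pathCount_zero (t : BinaryTree Unit) : pathCount t 0 = 0 := by
  induction t with
  | nil => rfl
  | node _ a b ha hb => simp [pathCount, ha]

theorem treeGF_pathCount (l : ℕ) : treeGF (fun t => (pathCount t l : ℚ)) =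
    (if l = 1 then catalanGF else 0) + X * ∑ p ∈ antidiagonal l,
      treeGF (fun t => (pathCount t p.1 : ℚ)) * treeGF (fun t => (pathCount t p.2 : ℚ)) := by
  have h : (fun t => (pathCount t l : ℚ)) = (fun _ => if l = 1 then 1 else 0) +
      ∑ p ∈ antidiagonal l,
        nodeWeight (fun t => (pathCount t p.1 : ℚ)) (fun t => (pathCount t p.2 : ℚ)) := by
    funext t
    cases t <;> simp [pathCount, nodeWeight, Finset.sum_apply]
  rw [h, treeGF_add, treeGF_sum, mul_sum]
  congr 1
  · split_ifs
    · exact treeGF_one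
    · ext m
      simp [treeGF]
  · exact sum_congr rfl fun p _ => treeGF_nodeWeight _ _

theorem treeGF_pathCount_succ (l : ℕ) : treeGF (fun t => (pathCount t (l + 1) : ℚ)) =
    C (catalan l : ℚ) * X ^ l * catalanGF ^ (l + 1) := by
  have hz : treeGF (fun t => (pathCount t 0 : ℚ)) = 0 := by
    ext m
    simp [treeGF, pathCount_zero]
  induction l using Nat.strong_induction_on with
  | _ l ih =>
  rw [treeGF_pathCount]
  cases l with
  | zero => simp [Nat.antidiagonal_succ, hz]
  | succ l =>
    -- No path has length 0, so both extreme terms drop; the rest is indexed by the antidiagonal of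
    -- `l`, as in the Catalan recurrence.
    rw [Nat.antidiagonal_succ, sum_cons, hz, zero_mul, zero_add, sum_map,
      Nat.antidiagonal_succ', sum_cons]
    simp only [Function.Embedding.prodMap, Function.Embedding.coeFn_mk, Prod.map,
      Nat.succ_eq_add_one, Function.Embedding.refl_apply, hz, mul_zero, zero_add, sum_map]
    rw [if_neg (by omega), zero_add, catalan_succ', Nat.cast_sum, map_sum, mul_sum, sum_mul,
      sum_mul]
    refine sum_congr rfl fun p hp => ?_
    rw [HasAntidiagonal.mem_antidiagonal] at hp
    rw [ih p.1 (by omega), ih p.2 (by omega), ← hp]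
    push_cast
    rw [map_mul]
    ring

/-- The cycles through the base edge of the root correspond to the paths with `l + 1` edges; `1 ≤ l`
excludes the base edge itself from these paths. The equation for the series is linear, and `1 - 2 X
c` can be cancelled. -/
theorem treeGF_cycleCount (l : ℕ) (hl : 1 ≤ l) : treeGF (fun t => (cycleCount t (l + 1) : ℚ)) =
    C (catalan l : ℚ) * X ^ l * chooseGF (l + 1) := by
  set Z := treeGF (fun t => (cycleCount t (l + 1) : ℚ)) with hZ
  have h : (fun t => (cycleCount t (l + 1) : ℚ)) =
      nodeWeight (fun t => (cycleCount t (l + 1) : ℚ)) (fun _ => 1) +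
      nodeWeight (fun _ => 1) (fun t => (cycleCount t (l + 1) : ℚ)) +
      ∑ p ∈ antidiagonal (l + 1),
        nodeWeight (fun t => (pathCount t p.1 : ℚ)) (fun t => (pathCount t p.2 : ℚ)) := by
    funext t
    cases t <;> simp [cycleCount, nodeWeight, Finset.sum_apply]
  have h1 : Z = X * (Z * catalanGF) + X * (catalanGF * Z) +
      treeGF (fun t => (pathCount t (l + 1) : ℚ)) := by
    conv_lhs => rw [hZ, h]
    rw [treeGF_add, treeGF_add, treeGF_sum, treeGF_nodeWeight, treeGF_nodeWeight, treeGF_one,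
      treeGF_pathCount (l + 1), if_neg (by omega), zero_add, mul_sum]
    congr 1
    exact sum_congr rfl fun p _ => treeGF_nodeWeight _ _
  rw [treeGF_pathCount_succ] at h1
  have hne : (1 - 2 * X * catalanGF : ℚ⟦X⟧) ≠ 0 := right_ne_zero_of_mul_eq_one chooseGF_zero_mul
  apply mul_right_cancel₀ hne
  linear_combination h1 - C (catalan l : ℚ) * X ^ l * chooseGF_mul (l + 1)

theorem sum_cycleCount (n k : ℕ) (hk : 3 ≤ k) (hkn : k < n) :
    ∑ t ∈ treesOfNumNodesEq (n - 2), (cycleCount t (k - 1) : ℚ) =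
      ((2 * n - k - 1).choose (n - 1) : ℚ) * (catalan (k - 2) : ℚ) := by
  obtain ⟨l, rfl⟩ : ∃ l, k = l + 2 := ⟨k - 2, by omega⟩
  obtain ⟨m, rfl⟩ : ∃ m, n = m + l + 2 := ⟨n - l - 2, by omega⟩
  have h := congrArg (coeff (m + l)) (treeGF_cycleCount l (by omega))
  rw [mul_assoc, coeff_C_mul, coeff_X_pow_mul] at h
  simp only [treeGF, chooseGF, coeff_mk] at h
  simp only [Nat.add_sub_cancel, show l + 2 - 1 = l + 1 by omega]
  rw [h, show 2 * (m + l + 2) - (l + 2) - 1 = 2 * m + (l + 1) by omega,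
    show m + l + 2 - 1 = 2 * m + (l + 1) - m by omega, Nat.choose_symm (by omega)]
  ring

end PolygonDissection

/-! ### Edge sets of binary trees as maximal noncrossing sets -/

namespace PolygonDissection

open Finset BinaryTree

/-- The sides and diagonals, written as increasing pairs, of the triangulation that belongs to a
binary tree: the polygon has the vertices `i, …, i + t.numLeaves`, the root of the tree is the
triangle on its base edge, and the subtrees triangulate the polygons cut off by that triangle. -/
def edges : BinaryTree Unit → ℕ → Finset (ℕ × ℕ)
  | nil, i => {(i, i + 1)}
  | node _ a b, i =>
    insert (i, i + a.numLeaves + b.numLeaves) (edges a i ∪ edges b (i + a.numLeaves))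

theorem bounds_of_mem_edges {t : BinaryTree Unit} {i u v : ℕ} (h : (u, v) ∈ edges t i) :
    i ≤ u ∧ u < v ∧ v ≤ i + t.numLeaves := by
  induction t generalizing i with
  | nil =>
    simp only [edges, mem_singleton, Prod.mk.injEq] at h
    simp
    omega
  | node _ a b ha hb =>
    have := a.numLeaves_pos
    have := b.numLeaves_pos
    simp only [edges, mem_insert, mem_union, Prod.mk.injEq] at h
    simp only [numLeaves]
    rcases h with h | h | h
    · omega
    · have := ha h
      omega
    · have := hb h
      omega

theorem base_mem_edges (t : BinaryTree Unit) (i : ℕ) : (i, i + t.numLeaves) ∈ edges t i := by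
  cases t <;> simp [edges, add_assoc]

theorem side_mem_edges {t : BinaryTree Unit} {i u : ℕ} (h : i ≤ u) (h' : u < i + t.numLeaves) :
    (u, u + 1) ∈ edges t i := by
  induction t generalizing i with
  | nil =>
    simp only [numLeaves] at h'
    simp only [edges, mem_singleton, Prod.mk.injEq]
    omega
  | node _ a b ha hb =>
    simp only [numLeaves] at h'
    simp only [edges, mem_insert, mem_union]
    rcases lt_or_ge u (i + a.numLeaves) with hu | hu
    · exact Or.inr (Or.inl (ha h hu))
    · exact Or.inr (Or.inr (hb hu (by omega)))

section Node

variable {x : Unit} {a b : BinaryTree Unit} {i u v : ℕ}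

theorem mem_edges_left (h : (u, v) ∈ edges (node x a b) i) (hv : v ≤ i + a.numLeaves) :
    (u, v) ∈ edges a i := by
  have := b.numLeaves_pos
  simp only [edges, mem_insert, mem_union, Prod.mk.injEq] at h
  rcases h with h | h | h
  · omega
  · exact h
  · have := bounds_of_mem_edges h
    omega

theorem mem_edges_right (h : (u, v) ∈ edges (node x a b) i) (hu : i + a.numLeaves ≤ u) :
    (u, v) ∈ edges b (i + a.numLeaves) := by
  have := a.numLeaves_pos
  simp only [edges, mem_insert, mem_union, Prod.mk.injEq] at h
  rcases h with h | h | h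
  · omega
  · have := bounds_of_mem_edges h
    omega
  · exact h

theorem eq_base_of_mem_edges (h : (u, v) ∈ edges (node x a b) i) (hu : u < i + a.numLeaves)
    (hv : i + a.numLeaves < v) : u = i ∧ v = i + a.numLeaves + b.numLeaves := by
  simp only [edges, mem_insert, mem_union, Prod.mk.injEq] at h
  rcases h with h | h | h
  · exact h
  · have := bounds_of_mem_edges h
    omega
  · have := bounds_of_mem_edges h
    omega

theorem left_subset_edges : edges a i ⊆ edges (node x a b) i := fun e he => by
  simp only [edges, mem_insert, mem_union]
  exact Or.inr (Or.inl he)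

theorem right_subset_edges : edges b (i + a.numLeaves) ⊆ edges (node x a b) i := fun e he => by
  simp only [edges, mem_insert, mem_union]
  exact Or.inr (Or.inr he)

end Node

/-- This count later turns the inclusion of a triangulation in the edge set of a tree into an
equality. -/
theorem card_edges (t : BinaryTree Unit) (i : ℕ) : (edges t i).card + 1 = 2 * t.numLeaves := by
  induction t generalizing i with
  | nil => simp [edges]
  | node _ a b ha hb =>
    have hd : Disjoint (edges a i) (edges b (i + a.numLeaves)) := by
      rw [disjoint_left]
      rintro ⟨u, v⟩ h h'
      have := bounds_of_mem_edges h
      have := bounds_of_mem_edges h'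
      omega
    have hn : (i, i + a.numLeaves + b.numLeaves) ∉ edges a i ∪ edges b (i + a.numLeaves) := by
      have := a.numLeaves_pos
      have := b.numLeaves_pos
      rw [mem_union]
      rintro (h | h)
      · have := bounds_of_mem_edges h
        omega
      · have := bounds_of_mem_edges h
        omega
    rw [edges, card_insert_of_notMem hn, card_union_of_disjoint hd]
    have := ha i
    have := hb (i + a.numLeaves)
    simp only [numLeaves]
    omega

/-- A set of increasing pairs is noncrossing if no two of its members interlace. -/
def Noncrossing (E : Finset (ℕ × ℕ)) : Prop :=
  ∀ u v x y, (u, v) ∈ E → (x, y) ∈ E → u < x → x < v → v < y → False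

theorem noncrossing_edges (t : BinaryTree Unit) (i : ℕ) : Noncrossing (edges t i) := by
  induction t generalizing i with
  | nil =>
    intro u v x y h h'
    simp only [edges, mem_singleton, Prod.mk.injEq] at h h'
    omega
  | node _ a b ha hb =>
    intro u v x y h h' h1 h2 h3
    have hu := bounds_of_mem_edges h
    have hx := bounds_of_mem_edges h'
    simp only [numLeaves] at hu hx
    rcases le_or_gt y (i + a.numLeaves) with hy | hy
    · exact ha i u v x y (mem_edges_left h (by omega)) (mem_edges_left h' hy) h1 h2 h3
    · rcases le_or_gt (i + a.numLeaves) x with hm | hm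
      · rcases le_or_gt (i + a.numLeaves) u with hm' | hm'
        · exact hb _ u v x y (mem_edges_right h hm') (mem_edges_right h' hm) h1 h2 h3
        · have := eq_base_of_mem_edges h hm' (by omega)
          omega
      · have := eq_base_of_mem_edges h' hm hy
        omega

/-- An apex `m` over the base is chosen so that only the base itself can pass over it; the pairs on
either side of `m` are then handled by induction. -/
theorem exists_subset_edges (w i : ℕ) (hw : 1 ≤ w) (E : Finset (ℕ × ℕ))
    (hE : ∀ u v, (u, v) ∈ E → i ≤ u ∧ u < v ∧ v ≤ i + w) (hc : Noncrossing E) :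
    ∃ t : BinaryTree Unit, t.numLeaves = w ∧ E ⊆ edges t i := by
  induction w using Nat.strong_induction_on generalizing i E with
  | _ w ih =>
  rcases Nat.lt_or_ge 1 w with hw1 | hw1
  -- The apex is the farthest neighbour of `i` short of `i + w`, or `i + 1` if that is larger or
  -- there is none.
  · obtain ⟨m, hm1, hm2, hmE, hmax⟩ : ∃ m, i < m ∧ m < i + w ∧
        (m = i + 1 ∨ (i, m) ∈ E) ∧ ∀ y, (i, y) ∈ E → y < i + w → y ≤ m := by
      let T := insert (i + 1) ((E.filter fun e => e.1 = i ∧ e.2 < i + w).image Prod.snd)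
      have hT : T.Nonempty := ⟨i + 1, mem_insert_self _ _⟩
      have h1 : i + 1 ≤ T.max' hT := le_max' _ _ (mem_insert_self _ _)
      have h2 := T.max'_mem hT
      have h3 : ∀ y, (i, y) ∈ E → y < i + w → y ≤ T.max' hT := fun y hy hy' => by
        apply le_max'
        simp only [T, mem_insert, mem_image, mem_filter]
        exact Or.inr ⟨(i, y), ⟨hy, rfl, hy'⟩, rfl⟩
      generalize T.max' hT = m at *
      simp only [T, mem_insert, mem_image, mem_filter] at h2
      rcases h2 with h2 | ⟨⟨x, y⟩, ⟨hxy, rfl, hy⟩, rfl⟩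
      · exact ⟨m, by omega, by omega, Or.inl h2, h3⟩
      · exact ⟨y, by simpa using h1, hy, Or.inr hxy, h3⟩
    obtain ⟨a, haw, ha⟩ := ih (m - i) (by omega) i (by omega) (E.filter fun e => e.2 ≤ m)
      (fun u v h => by
        rw [mem_filter] at h
        have := hE u v h.1
        have := h.2
        dsimp only at this
        omega)
      (fun u v x y h h' => hc u v x y (mem_filter.1 h).1 (mem_filter.1 h').1)
    obtain ⟨b, hbw, hb⟩ := ih (i + w - m) (by omega) m (by omega) (E.filter fun e => m ≤ e.1)
      (fun u v h => by
        rw [mem_filter] at h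
        have := hE u v h.1
        have := h.2
        dsimp only at this
        omega)
      (fun u v x y h h' => hc u v x y (mem_filter.1 h).1 (mem_filter.1 h').1)
    refine ⟨node () a b, by simp only [numLeaves]; omega, ?_⟩
    rintro ⟨u, v⟩ he
    have hi : i + a.numLeaves = m := by omega
    have hb1 := hE u v he
    rcases le_or_gt v m with hv | hv
    · exact left_subset_edges (ha (mem_filter.2 ⟨he, hv⟩))
    rcases le_or_gt m u with hu | hu
    · exact right_subset_edges (by rw [hi]; exact hb (mem_filter.2 ⟨he, hu⟩))
    -- A pair passing over `m` must start at `i`, or it would cross `(i, m)`; by maximality of `m`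
    -- it must then end at `i + w`.
    have hui : u = i := by
      rcases hmE with rfl | hmE
      · omega
      · by_contra hne
        exact hc i m u v hmE he (by omega) hu hv
    subst hui
    have hvw : v = u + w := by
      by_contra hne
      have := hmax v he (by omega)
      omega
    simp only [edges, mem_insert, Prod.mk.injEq]
    exact Or.inl ⟨trivial, by omega⟩
  · refine ⟨nil, by simp only [numLeaves]; omega, ?_⟩
    rintro ⟨u, v⟩ he
    have := hE u v he
    simp only [edges, mem_singleton, Prod.mk.injEq]
    omega

/-- The edge set determines the apex: the edge from `i` to the apex of one tree would pass over a
smaller apex of the other, where only the base may pass. The subtrees are then recovered by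
restriction. -/
theorem edges_injective {t t' : BinaryTree Unit} {i : ℕ} (h : edges t i = edges t' i) :
    t = t' := by
  induction t generalizing t' i with
  | nil =>
    cases t' with
    | nil => rfl
    | node x a b =>
      have h1 := card_edges nil i
      have h2 := card_edges (node x a b) i
      have := a.numLeaves_pos
      have := b.numLeaves_pos
      rw [h] at h1
      simp only [numLeaves] at h1 h2
      omega
  | node x a b ha hb =>
    have hw : (node x a b).numLeaves = t'.numLeaves := by
      have h1 := card_edges (node x a b) i
      have h2 := card_edges t' i
      rw [h] at h1
      omega
    cases t' with
    | nil =>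
      have := a.numLeaves_pos
      have := b.numLeaves_pos
      simp only [numLeaves] at hw
      omega
    | node x' a' b' =>
      have key : ∀ {a b a' b' : BinaryTree Unit} {x x' : Unit},
          (node x a b).numLeaves = (node x' a' b').numLeaves →
          edges (node x a b) i = edges (node x' a' b') i → a.numLeaves ≤ a'.numLeaves := by
        intro a b a' b' x x' hw h
        have h1 : (i, i + a.numLeaves) ∈ edges (node x' a' b') i := by
          rw [← h]
          exact left_subset_edges (base_mem_edges a i)
        have := b.numLeaves_pos
        have := a'.numLeaves_pos
        simp only [numLeaves] at hw
        by_contra hlt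
        have := eq_base_of_mem_edges h1 (by omega) (by omega)
        omega
      have hm : a.numLeaves = a'.numLeaves := le_antisymm (key hw h) (key hw.symm h.symm)
      have hl : edges a i = edges a' i := by
        ext ⟨u, v⟩
        constructor
        · intro he
          have := bounds_of_mem_edges he
          exact mem_edges_left (h ▸ left_subset_edges he) (by omega)
        · intro he
          have := bounds_of_mem_edges he
          exact mem_edges_left (h.symm ▸ left_subset_edges he) (by omega)
      have hr : edges b (i + a.numLeaves) = edges b' (i + a.numLeaves) := by
        ext ⟨u, v⟩
        constructor
        · intro he
          have := bounds_of_mem_edges he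
          rw [hm]
          exact mem_edges_right (h ▸ right_subset_edges he) (by omega)
        · intro he
          have := bounds_of_mem_edges he
          rw [hm] at he
          exact mem_edges_right (h.symm ▸ right_subset_edges he) (by omega)
      rw [ha hl, hb hr]

end PolygonDissection

/-! ### Vertex sets of monotone paths and of cycles -/

namespace PolygonDissection

open Finset BinaryTree

/-- Any two consecutive elements of `S` form an edge in `E`. -/
def IsPathIn (E : Finset (ℕ × ℕ)) (S : Finset ℕ) : Prop :=
  ∀ u ∈ S, ∀ v ∈ S, u < v → (∀ x ∈ S, x ≤ u ∨ v ≤ x) → (u, v) ∈ E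

/-- Any two cyclically consecutive elements of `S` form an edge in `E`. -/
def IsCycleIn (E : Finset (ℕ × ℕ)) (S : Finset ℕ) : Prop :=
  IsPathIn E S ∧ ∀ u ∈ S, ∀ v ∈ S, u < v → (∀ x ∈ S, u ≤ x ∧ x ≤ v) → (u, v) ∈ E

/-- The vertex sets of the monotone paths that join the end points of the base edge. -/
def pathSets : BinaryTree Unit → ℕ → Finset (Finset ℕ)
  | nil, i => {{i, i + 1}}
  | node _ a b, i => insert {i, i + a.numLeaves + b.numLeaves}
      (image₂ (· ∪ ·) (pathSets a i) (pathSets b (i + a.numLeaves)))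

/-- The vertex sets of the cycles. -/
def cycleSets : BinaryTree Unit → ℕ → Finset (Finset ℕ)
  | nil, _ => ∅
  | node _ a b, i => cycleSets a i ∪ cycleSets b (i + a.numLeaves) ∪
      image₂ (· ∪ ·) (pathSets a i) (pathSets b (i + a.numLeaves))

theorem exists_consecutive {S : Finset ℕ} {a b m : ℕ} (ha : a ∈ S) (hb : b ∈ S) (ham : a < m)
    (hmb : m < b) (hm : m ∉ S) :
    ∃ u ∈ S, ∃ v ∈ S, u < m ∧ m < v ∧ ∀ x ∈ S, x ≤ u ∨ v ≤ x := by
  obtain ⟨u, hu, hu'⟩ := (S.filter (· < m)).exists_max_image id ⟨a, by simp [ha, ham]⟩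
  obtain ⟨v, hv, hv'⟩ := (S.filter (m < ·)).exists_min_image id ⟨b, by simp [hb, hmb]⟩
  simp only [mem_filter, id_eq] at hu hu' hv hv'
  refine ⟨u, hu.1, v, hv.1, hu.2, hv.2, fun x hx => ?_⟩
  rcases lt_trichotomy x m with h | rfl | h
  · exact Or.inl (hu' x ⟨hx, h⟩)
  · exact absurd hx hm
  · exact Or.inr (hv' x ⟨hx, h⟩)

/-- A path through the apex `m` splits there into two paths. A path avoiding `m` has an edge passing
over `m`, which can only be the base. -/
theorem mem_pathSets {t : BinaryTree Unit} {i : ℕ} {S : Finset ℕ} : S ∈ pathSets t i ↔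
    i ∈ S ∧ i + t.numLeaves ∈ S ∧ (∀ x ∈ S, i ≤ x ∧ x ≤ i + t.numLeaves) ∧
      IsPathIn (edges t i) S := by
  induction t generalizing i S with
  | nil =>
    simp only [pathSets, mem_singleton, numLeaves, IsPathIn, edges, Prod.mk.injEq]
    constructor
    · rintro rfl
      simp only [mem_insert, mem_singleton]
      refine ⟨by simp, by simp, fun x hx => by omega, fun u hu v hv h _ => by omega⟩
    · rintro ⟨h1, h2, h3, -⟩
      ext x
      simp only [mem_insert, mem_singleton]
      constructor
      · intro hx
        have := h3 x hx
        omega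
      · rintro (rfl | rfl) <;> assumption
  | node x a b ha hb =>
    have hpa := a.numLeaves_pos
    have hpb := b.numLeaves_pos
    simp only [pathSets, mem_insert, mem_image₂, numLeaves, ← add_assoc]
    set m := i + a.numLeaves with hm
    constructor
    · rintro (rfl | ⟨S₁, h₁, S₂, h₂, rfl⟩)
      · simp only [IsPathIn, mem_insert, mem_singleton]
        refine ⟨by simp, by simp, fun y hy => by omega, fun u hu v hv h _ => ?_⟩
        obtain ⟨rfl, rfl⟩ : u = i ∧ v = m + b.numLeaves := by omega
        simp [edges, hm]
      · obtain ⟨hi1, hm1, hb1, hp1⟩ := ha.1 h₁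
        obtain ⟨hm2, hj2, hb2, hp2⟩ := hb.1 h₂
        refine ⟨mem_union_left _ hi1, mem_union_right _ hj2, fun y hy => ?_, ?_⟩
        · rcases mem_union.1 hy with hy | hy
          · have := hb1 y hy
            omega
          · have := hb2 y hy
            omega
        · intro u hu v hv huv hcons
          rcases hcons m (mem_union_left _ hm1) with hmu | hvm
          · have hv2 : v ∈ S₂ := (mem_union.1 hv).resolve_left fun h => by
              have := hb1 v h
              omega
            have hu2 : u ∈ S₂ := by
              rcases mem_union.1 hu with h | h
              · have := hb1 u h
                obtain rfl : u = m := by omega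
                exact hm2
              · exact h
            exact right_subset_edges
              (hp2 u hu2 v hv2 huv fun y hy => hcons y (mem_union_right _ hy))
          · have hu1 : u ∈ S₁ := (mem_union.1 hu).resolve_right fun h => by
              have := hb2 u h
              omega
            have hv1 : v ∈ S₁ := by
              rcases mem_union.1 hv with h | h
              · exact h
              · have := hb2 v h
                obtain rfl : v = m := by omega
                exact hm1
            exact left_subset_edges
              (hp1 u hu1 v hv1 huv fun y hy => hcons y (mem_union_left _ hy))
    · rintro ⟨hi, hj, hbd, hp⟩
      by_cases hmS : m ∈ S
      · right
        refine ⟨S.filter (· ≤ m), ?_, S.filter (m ≤ ·), ?_, ?_⟩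
        · rw [ha]
          refine ⟨mem_filter.2 ⟨hi, by omega⟩, mem_filter.2 ⟨hmS, le_rfl⟩, fun y hy => ?_, ?_⟩
          · rw [mem_filter] at hy
            have := hbd y hy.1
            omega
          · intro u hu v hv huv hcons
            rw [mem_filter] at hu hv
            refine mem_edges_left (hp u hu.1 v hv.1 huv fun y hy => ?_) hv.2
            rcases le_or_gt y m with h | h
            · exact hcons y (mem_filter.2 ⟨hy, h⟩)
            · omega
        · rw [hb]
          refine ⟨mem_filter.2 ⟨hmS, le_rfl⟩, mem_filter.2 ⟨hj, by omega⟩, fun y hy => ?_, ?_⟩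
          · rw [mem_filter] at hy
            have := hbd y hy.1
            omega
          · intro u hu v hv huv hcons
            rw [mem_filter] at hu hv
            refine mem_edges_right (hp u hu.1 v hv.1 huv fun y hy => ?_) hu.2
            rcases le_or_gt m y with h | h
            · exact hcons y (mem_filter.2 ⟨hy, h⟩)
            · omega
        · ext y
          simp only [mem_union, mem_filter, ← and_or_left]
          exact and_iff_left (le_total y m)
      · left
        obtain ⟨u, hu, v, hv, hum, hmv, hcons⟩ :=
          exists_consecutive hi hj (by omega) (by omega) hmS
        obtain ⟨rfl, rfl⟩ := eq_base_of_mem_edges (hp u hu v hv (by omega) hcons) hum hmv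
        ext y
        simp only [mem_insert, mem_singleton]
        constructor
        · intro hy
          have := hbd y hy
          have := hcons y hy
          omega
        · rintro (rfl | rfl) <;> assumption

theorem mem_image₂_pathSets {x : Unit} {a b : BinaryTree Unit} {i : ℕ} {S : Finset ℕ} :
    S ∈ image₂ (· ∪ ·) (pathSets a i) (pathSets b (i + a.numLeaves)) ↔
      S ∈ pathSets (node x a b) i ∧ i + a.numLeaves ∈ S := by
  have hpa := a.numLeaves_pos
  have hpb := b.numLeaves_pos
  rw [pathSets, mem_insert]
  constructor
  · intro h
    refine ⟨Or.inr h, ?_⟩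
    obtain ⟨S₁, h₁, S₂, h₂, rfl⟩ := mem_image₂.1 h
    exact mem_union_left _ (mem_pathSets.1 h₁).2.1
  · rintro ⟨rfl | h, h'⟩
    · simp only [mem_insert, mem_singleton] at h'
      omega
    · exact h

/-- The least and greatest elements of a cycle are joined by an edge. If that edge stays on one side
of the apex, so does the cycle; otherwise it is the base. -/
theorem mem_cycleSets {t : BinaryTree Unit} {i : ℕ} {S : Finset ℕ} : S ∈ cycleSets t i ↔
    3 ≤ S.card ∧ (∀ x ∈ S, i ≤ x ∧ x ≤ i + t.numLeaves) ∧ IsCycleIn (edges t i) S := by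
  induction t generalizing i S with
  | nil =>
    simp only [cycleSets, notMem_empty, false_iff, numLeaves]
    rintro ⟨h1, h2, -⟩
    have : S ⊆ {i, i + 1} := fun x hx => by
      have := h2 x hx
      simp only [mem_insert, mem_singleton]
      omega
    have := card_le_card this
    have := card_le_two (a := i) (b := i + 1)
    omega
  | node x a b ha hb =>
    have hpa := a.numLeaves_pos
    have hpb := b.numLeaves_pos
    rw [cycleSets, mem_union, mem_union, ha, hb, mem_image₂_pathSets (x := x), mem_pathSets]
    simp only [numLeaves, ← add_assoc]
    set m := i + a.numLeaves with hm
    constructor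
    · rintro ((⟨h1, h2, h3, h4⟩ | ⟨h1, h2, h3, h4⟩) | ⟨⟨h1, h2, h3, h4⟩, h5⟩)
      · refine ⟨h1, fun y hy => ?_, fun u hu v hv h h' => left_subset_edges (h3 u hu v hv h h'),
          fun u hu v hv h h' => left_subset_edges (h4 u hu v hv h h')⟩
        have := h2 y hy
        omega
      · refine ⟨h1, fun y hy => ?_, fun u hu v hv h h' => right_subset_edges (h3 u hu v hv h h'),
          fun u hu v hv h h' => right_subset_edges (h4 u hu v hv h h')⟩
        have := h2 y hy
        omega
      · refine ⟨?_, h3, h4, fun u hu v hv h h' => ?_⟩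
        · have h3 : ({i, m, m + b.numLeaves} : Finset ℕ).card = 3 :=
            card_eq_three.2 ⟨_, _, _, by omega, by omega, by omega, rfl⟩
          rw [← h3]
          apply card_le_card
          intro y
          simp only [mem_insert, mem_singleton]
          rintro (rfl | rfl | rfl) <;> assumption
        · have := h' _ h1
          have := h' _ h2
          have := h3 _ hu
          have := h3 _ hv
          obtain ⟨rfl, rfl⟩ : u = i ∧ v = m + b.numLeaves := by omega
          simp [edges, hm]
    · rintro ⟨h1, h2, h3, h4⟩
      have hne : S.Nonempty := card_pos.1 (by omega)
      obtain ⟨u, hu, hu'⟩ := S.exists_min_image id hne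
      obtain ⟨v, hv, hv'⟩ := S.exists_max_image id hne
      simp only [id_eq] at hu' hv'
      have huv : u < v := by
        by_contra hlt
        have : S ⊆ {u} := fun y hy => by
          have := hu' y hy
          have := hv' y hy
          simp only [mem_singleton]
          omega
        have := card_le_card this
        simp at this
        omega
      have he := h4 u hu v hv huv fun y hy => ⟨hu' y hy, hv' y hy⟩
      rcases le_or_gt v m with hvm | hvm
      · refine Or.inl (Or.inl ⟨h1, fun y hy => ⟨(h2 y hy).1, (hv' y hy).trans hvm⟩,
          fun p hp q hq h h' => mem_edges_left (h3 p hp q hq h h') ((hv' q hq).trans hvm),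
          fun p hp q hq h h' => mem_edges_left (h4 p hp q hq h h') ((hv' q hq).trans hvm)⟩)
      rcases le_or_gt m u with hum | hum
      · refine Or.inl (Or.inr ⟨h1, fun y hy => ⟨hum.trans (hu' y hy), (h2 y hy).2⟩,
          fun p hp q hq h h' => mem_edges_right (h3 p hp q hq h h') (hum.trans (hu' p hp)),
          fun p hp q hq h h' => mem_edges_right (h4 p hp q hq h h') (hum.trans (hu' p hp))⟩)
      obtain ⟨rfl, rfl⟩ := eq_base_of_mem_edges he hum hvm
      refine Or.inr ⟨⟨hu, hv, h2, h3⟩, ?_⟩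
      -- Without the apex, two consecutive elements would be the ends of the base, leaving only two
      -- vertices.
      by_contra hmS
      obtain ⟨p, hp, q, hq, hpm, hmq, hcons⟩ := exists_consecutive hu hv hum hvm hmS
      obtain ⟨rfl, rfl⟩ := eq_base_of_mem_edges (h3 p hp q hq (by omega) hcons) hpm hmq
      have : S ⊆ {p, m + b.numLeaves} := fun y hy => by
        have := hcons y hy
        have := h2 y hy
        simp only [mem_insert, mem_singleton]
        omega
      have := card_le_card this
      have := card_le_two (a := p) (b := m + b.numLeaves)
      omega

/-- The two halves share exactly the apex, so edge numbers (vertices minus one) add up, and the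
union determines both halves. -/
theorem card_filter_image₂ {a b : BinaryTree Unit} {i l : ℕ}
    (ha : ∀ l, #{S ∈ pathSets a i | #S = l + 1} = pathCount a l)
    (hb : ∀ l, #{S ∈ pathSets b (i + a.numLeaves) | #S = l + 1} = pathCount b l) :
    #{S ∈ image₂ (· ∪ ·) (pathSets a i) (pathSets b (i + a.numLeaves)) | #S = l + 1} =
      ∑ p ∈ antidiagonal l, pathCount a p.1 * pathCount b p.2 := by
  set m := i + a.numLeaves with hm
  have hcard : ∀ S₁ ∈ pathSets a i, ∀ S₂ ∈ pathSets b m,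
      #(S₁ ∪ S₂) + 1 = #S₁ + #S₂ ∧ 1 ≤ #S₁ ∧ 1 ≤ #S₂ := by
    intro S₁ h₁ S₂ h₂
    obtain ⟨hi1, hm1, hb1, -⟩ := mem_pathSets.1 h₁
    obtain ⟨hm2, hj2, hb2, -⟩ := mem_pathSets.1 h₂
    refine ⟨?_, card_pos.2 ⟨_, hi1⟩, card_pos.2 ⟨_, hm2⟩⟩
    have : S₁ ∩ S₂ = {m} := by
      ext y
      simp only [mem_inter, mem_singleton]
      constructor
      · rintro ⟨h, h'⟩
        have := hb1 y h
        have := hb2 y h'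
        omega
      · rintro rfl
        exact ⟨hm1, hm2⟩
    rw [← card_union_add_card_inter, this, card_singleton]
  have hinj : Set.InjOn (fun p : Finset ℕ × Finset ℕ => p.1 ∪ p.2)
      (pathSets a i ×ˢ pathSets b m : Finset _) := by
    rintro ⟨S₁, S₂⟩ h ⟨T₁, T₂⟩ h' heq
    simp only [coe_product, Set.mem_prod, mem_coe] at h h' heq
    obtain ⟨-, hm1, hb1, -⟩ := mem_pathSets.1 h.1
    obtain ⟨hm2, -, hb2, -⟩ := mem_pathSets.1 h.2
    obtain ⟨-, hm1', hb1', -⟩ := mem_pathSets.1 h'.1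
    obtain ⟨hm2', -, hb2', -⟩ := mem_pathSets.1 h'.2
    have hmem : ∀ y, (y ∈ S₁ ∨ y ∈ S₂) ↔ (y ∈ T₁ ∨ y ∈ T₂) := fun y => by
      rw [← mem_union, ← mem_union, heq]
    have hl : S₁ = T₁ := by
      ext y
      rcases lt_trichotomy y m with hy | rfl | hy
      · have e1 : y ∉ S₂ := fun h => absurd (hb2 y h).1 (by omega)
        have e2 : y ∉ T₂ := fun h => absurd (hb2' y h).1 (by omega)
        simpa [e1, e2] using hmem y
      · exact iff_of_true hm1 hm1'
      · exact iff_of_false (fun h => absurd (hb1 y h).2 (by omega))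
          (fun h => absurd (hb1' y h).2 (by omega))
    have hr : S₂ = T₂ := by
      ext y
      rcases lt_trichotomy y m with hy | rfl | hy
      · exact iff_of_false (fun h => absurd (hb2 y h).1 (by omega))
          (fun h => absurd (hb2' y h).1 (by omega))
      · exact iff_of_true hm2 hm2'
      · have e1 : y ∉ S₁ := fun h => absurd (hb1 y h).2 (by omega)
        have e2 : y ∉ T₁ := fun h => absurd (hb1' y h).2 (by omega)
        simpa [e1, e2] using hmem y
    rw [hl, hr]
  have himage : image₂ (· ∪ ·) (pathSets a i) (pathSets b m) =
      (pathSets a i ×ˢ pathSets b m).image fun p => p.1 ∪ p.2 := rfl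
  rw [himage, filter_image, card_image_of_injOn]
  · rw [card_eq_sum_card_fiberwise (f := fun p => (#p.1 - 1, #p.2 - 1)) (t := antidiagonal l)]
    · refine sum_congr rfl fun p hp => ?_
      rw [HasAntidiagonal.mem_antidiagonal] at hp
      rw [← ha, ← hb, ← card_product]
      congr 1
      ext ⟨S₁, S₂⟩
      simp only [mem_filter, mem_product, Prod.ext_iff]
      constructor
      · rintro ⟨⟨⟨h₁, h₂⟩, h⟩, h'⟩
        have := hcard S₁ h₁ S₂ h₂
        exact ⟨⟨h₁, by omega⟩, h₂, by omega⟩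
      · rintro ⟨⟨h₁, h⟩, h₂, h'⟩
        have := hcard S₁ h₁ S₂ h₂
        exact ⟨⟨⟨h₁, h₂⟩, by omega⟩, by omega, by omega⟩
    · rintro ⟨S₁, S₂⟩ h
      simp only [coe_filter, Set.mem_ofPred_eq, mem_product] at h
      have := hcard S₁ h.1.1 S₂ h.1.2
      simp only [mem_coe, HasAntidiagonal.mem_antidiagonal]
      omega
  · exact hinj.mono (by
      rw [coe_subset]
      exact filter_subset _ _)

theorem card_filter_pathSets (t : BinaryTree Unit) (i l : ℕ) :
    #{S ∈ pathSets t i | #S = l + 1} = pathCount t l := by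
  induction t generalizing i l with
  | nil =>
    have : #{i, i + 1} = 2 := card_pair (by omega)
    by_cases hl : l = 1
    · simp [pathSets, pathCount, filter_singleton, this, hl]
    · have : ¬ (2 = l + 1) := by omega
      simp [pathSets, pathCount, filter_singleton, *]
  | node x a b ha hb =>
    have hpa := a.numLeaves_pos
    have hpb := b.numLeaves_pos
    have h2 : #{i, i + a.numLeaves + b.numLeaves} = 2 := card_pair (by omega)
    have hn : ({i, i + a.numLeaves + b.numLeaves} : Finset ℕ) ∉
        image₂ (· ∪ ·) (pathSets a i) (pathSets b (i + a.numLeaves)) := fun h => by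
      have := (mem_image₂_pathSets (x := x).1 h).2
      simp only [mem_insert, mem_singleton] at this
      omega
    rw [pathSets, filter_insert, pathCount, h2]
    by_cases hl : l = 1
    · rw [if_pos (by omega), if_pos hl, card_insert_of_notMem fun h => hn (mem_filter.1 h).1,
        card_filter_image₂ (ha i) (hb _), add_comm]
    · rw [if_neg (by omega), if_neg hl, card_filter_image₂ (ha i) (hb _), zero_add]

/-- The three kinds of cycles are disjoint: the two subpolygons share only the apex, and neither
contains both ends of the base. -/
theorem card_filter_cycleSets (t : BinaryTree Unit) (i l : ℕ) :
    #{S ∈ cycleSets t i | #S = l + 1} = cycleCount t l := by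
  induction t generalizing i l with
  | nil => simp [cycleSets, cycleCount]
  | node x a b ha hb =>
    have hpa := a.numLeaves_pos
    have hpb := b.numLeaves_pos
    rw [cycleSets, cycleCount, filter_union, filter_union, card_union_of_disjoint,
      card_union_of_disjoint, ha, hb, card_filter_image₂ (card_filter_pathSets a i)
      (card_filter_pathSets b _)]
    · rw [disjoint_left]
      intro S h h'
      obtain ⟨h1, h2, -⟩ := mem_cycleSets.1 (mem_filter.1 h).1
      obtain ⟨-, h3, -⟩ := mem_cycleSets.1 (mem_filter.1 h').1
      have : S ⊆ {i + a.numLeaves} := fun y hy => by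
        have := h2 y hy
        have := h3 y hy
        simp only [mem_singleton]
        omega
      have := card_le_card this
      simp at this
      omega
    · rw [disjoint_left]
      intro S h h'
      have h1 := (mem_image₂_pathSets (x := x).1 (mem_filter.1 h').1).1
      obtain ⟨hi, hj, -⟩ := mem_pathSets.1 h1
      simp only [numLeaves] at hj
      rw [← filter_union, mem_filter, mem_union] at h
      rcases h.1 with h | h
      · have := (mem_cycleSets.1 h).2.1 _ hj
        omega
      · have := (mem_cycleSets.1 h).2.1 _ hi
        omega

end PolygonDissection

/-! ### Triangulations correspond to binary trees -/

namespace PolygonDissection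

open Finset BinaryTree

theorem cycleGraph_adj_of_lt {n : ℕ} {u v : Fin n} (h : u < v) :
    (SimpleGraph.cycleGraph n).Adj u v ↔ v.val = u.val + 1 ∨ (u.val = 0 ∧ v.val + 1 = n) := by
  rw [SimpleGraph.cycleGraph_adj', Fin.coe_sub_iff_lt.2 h, Fin.coe_sub_iff_le.2 h.le]
  rw [Fin.lt_def] at h
  omega

open Classical in
/-- The edges of a graph on `Fin n`, as increasing pairs of natural numbers. -/
noncomputable def edgePairs {n : ℕ} (G : SimpleGraph (Fin n)) : Finset (ℕ × ℕ) :=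
  (univ.filter fun p : Fin n × Fin n => p.1 < p.2 ∧ G.Adj p.1 p.2).image
    fun p => (p.1.val, p.2.val)

theorem mem_edgePairs {n : ℕ} {G : SimpleGraph (Fin n)} {u v : ℕ} : (u, v) ∈ edgePairs G ↔
    ∃ (hu : u < n) (hv : v < n), u < v ∧ G.Adj ⟨u, hu⟩ ⟨v, hv⟩ := by
  simp only [edgePairs, mem_image, mem_filter, mem_univ, true_and, Prod.exists, Prod.mk.injEq]
  constructor
  · rintro ⟨a, b, ⟨h, h'⟩, rfl, rfl⟩
    exact ⟨a.2, b.2, h, h'⟩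
  · rintro ⟨hu, hv, h, h'⟩
    exact ⟨⟨u, hu⟩, ⟨v, hv⟩, ⟨h, h'⟩, rfl, rfl⟩

theorem mk_mem_edgePairs {n : ℕ} {G : SimpleGraph (Fin n)} {u v : Fin n} (h : u < v) :
    (u.val, v.val) ∈ edgePairs G ↔ G.Adj u v :=
  mem_edgePairs.trans ⟨fun ⟨_, _, _, h'⟩ => h', fun h' => ⟨u.2, v.2, h, h'⟩⟩

/-- The sides of the `n`-gon, as increasing pairs of natural numbers. -/
def sidePairs (n : ℕ) : Finset (ℕ × ℕ) :=
  insert (0, n - 1) ((range (n - 1)).image fun u => (u, u + 1))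

theorem card_sidePairs {n : ℕ} (hn : 3 ≤ n) : #(sidePairs n) = n := by
  rw [sidePairs, card_insert_of_notMem, card_image_of_injective, card_range]
  · omega
  · intro u v h
    exact (Prod.mk.inj h).1
  · simp only [mem_image, mem_range, Prod.mk.injEq, not_exists]
    omega

theorem mem_sidePairs {n : ℕ} (hn : 3 ≤ n) {u v : ℕ} :
    (u, v) ∈ sidePairs n ↔ (v = u + 1 ∧ v < n) ∨ (u = 0 ∧ v + 1 = n) := by
  simp only [sidePairs, mem_insert, mem_image, mem_range, Prod.mk.injEq]
  constructor
  · rintro (h | ⟨x, h⟩) <;> omega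
  · rintro (h | h)
    · exact Or.inr ⟨u, by omega⟩
    · omega

theorem graph_adj {n : ℕ} {D : Finset (Sym2 (Fin n))} {u v : Fin n} (h : u < v) :
    (graph D).Adj u v ↔ (SimpleGraph.cycleGraph n).Adj u v ∨ s(u, v) ∈ D := by
  simp [graph, h.ne]

/-- The end points of a chord in increasing order. -/
def toPair {n : ℕ} (e : Sym2 (Fin n)) : ℕ × ℕ := (e.inf.val, e.sup.val)

theorem toPair_mk {n : ℕ} {u v : Fin n} (h : u < v) : toPair s(u, v) = (u.val, v.val) := by
  simp [toPair, h.le]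

theorem toPair_injective {n : ℕ} : Function.Injective (toPair (n := n)) := by
  intro e f h
  rw [toPair, toPair, Prod.mk.injEq, Fin.val_inj, Fin.val_inj] at h
  exact Sym2.inf_eq_inf_and_sup_eq_sup.1 h

theorem IsDiagonal.exists_lt {n : ℕ} {e : Sym2 (Fin n)} (he : IsDiagonal e) :
    ∃ u v : Fin n, u < v ∧ e = s(u, v) ∧ ¬ (SimpleGraph.cycleGraph n).Adj u v := by
  induction e with
  | _ u v =>
  obtain ⟨h1, h2⟩ := he
  rw [Sym2.mk_isDiag_iff] at h1
  rw [SimpleGraph.mem_edgeSet] at h2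
  rcases lt_or_gt_of_ne h1 with h | h
  · exact ⟨u, v, h, rfl, h2⟩
  · exact ⟨v, u, h, Sym2.eq_swap, fun h' => h2 h'.symm⟩

theorem edgePairs_graph {n : ℕ} (hn : 3 ≤ n) {D : Finset (Sym2 (Fin n))}
    (hD : ∀ e ∈ D, IsDiagonal e) : edgePairs (graph D) = sidePairs n ∪ D.image toPair := by
  ext ⟨u, v⟩
  rw [mem_edgePairs, mem_union, mem_sidePairs hn, mem_image]
  constructor
  · rintro ⟨hu, hv, huv, h⟩
    have hlt : (⟨u, hu⟩ : Fin n) < ⟨v, hv⟩ := huv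
    rw [graph_adj hlt, cycleGraph_adj_of_lt hlt] at h
    rcases h with h | h
    · left
      dsimp only at h
      omega
    · exact Or.inr ⟨_, h, toPair_mk hlt⟩
  · rintro (h | ⟨e, he, h⟩)
    · have hlt : (⟨u, by omega⟩ : Fin n) < ⟨v, by omega⟩ := by
        rw [Fin.lt_def]
        dsimp only
        omega
      refine ⟨by omega, by omega, hlt, ?_⟩
      rw [graph_adj hlt, cycleGraph_adj_of_lt hlt]
      left
      dsimp only
      omega
    · obtain ⟨a, b, hab, rfl, -⟩ := (hD e he).exists_lt
      rw [toPair_mk hab, Prod.mk.injEq] at h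
      obtain ⟨rfl, rfl⟩ := h
      exact ⟨a.2, b.2, hab, (graph_adj hab).2 (Or.inr he)⟩

theorem card_edgePairs_graph {n : ℕ} (hn : 3 ≤ n) {D : Finset (Sym2 (Fin n))}
    (hD : ∀ e ∈ D, IsDiagonal e) : #(edgePairs (graph D)) = #D + n := by
  rw [edgePairs_graph hn hD, card_union_of_disjoint, card_sidePairs hn,
    card_image_of_injective _ toPair_injective, add_comm]
  rw [disjoint_left]
  rintro ⟨u, v⟩ h h'
  obtain ⟨e, he, h'⟩ := mem_image.1 h'
  obtain ⟨a, b, hab, rfl, hn'⟩ := (hD e he).exists_lt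
  rw [toPair_mk hab, Prod.mk.injEq] at h'
  obtain ⟨rfl, rfl⟩ := h'
  rw [mem_sidePairs hn] at h
  rw [cycleGraph_adj_of_lt hab] at hn'
  omega

theorem subset_of_edgePairs_graph_subset {n : ℕ} {D D' : Finset (Sym2 (Fin n))}
    (hD : ∀ e ∈ D, IsDiagonal e) (h : edgePairs (graph D) ⊆ edgePairs (graph D')) : D ⊆ D' := by
  intro e he
  obtain ⟨a, b, hab, rfl, hn⟩ := (hD e he).exists_lt
  have h1 := h ((mk_mem_edgePairs hab).2 ((graph_adj hab).2 (Or.inr he)))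
  rw [mk_mem_edgePairs hab, graph_adj hab] at h1
  exact h1.resolve_left hn

theorem noncrossing_edgePairs_graph {n : ℕ} {D : Finset (Sym2 (Fin n))}
    (hD : ∀ e ∈ D, ∀ f ∈ D, ¬ Cross e f) : Noncrossing (edgePairs (graph D)) := by
  intro u v x y h h' h1 h2 h3
  obtain ⟨hu, hv, huv, h⟩ := mem_edgePairs.1 h
  obtain ⟨hx, hy, hxy, h'⟩ := mem_edgePairs.1 h'
  have l1 : (⟨u, hu⟩ : Fin n) < ⟨v, hv⟩ := huv
  have l2 : (⟨x, hx⟩ : Fin n) < ⟨y, hy⟩ := hxy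
  rw [graph_adj l1, cycleGraph_adj_of_lt l1] at h
  rw [graph_adj l2, cycleGraph_adj_of_lt l2] at h'
  -- A side interlaces with no pair, so both edges are diagonals of `D`.
  have e1 := h.resolve_left (by dsimp only; omega)
  have e2 := h'.resolve_left (by dsimp only; omega)
  exact hD _ e1 _ e2 ⟨_, _, _, _, h1, h2, h3, Or.inl ⟨rfl, rfl⟩⟩

theorem not_cross_of_noncrossing {n : ℕ} {D : Finset (Sym2 (Fin n))}
    (h : Noncrossing (edgePairs (graph D))) : ∀ e ∈ D, ∀ f ∈ D, ¬ Cross e f := by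
  rintro e he f hf ⟨a, b, c, d, hab, hbc, hcd, hef⟩
  obtain ⟨h1, h2⟩ : s(a, c) ∈ D ∧ s(b, d) ∈ D := by
    rcases hef with ⟨rfl, rfl⟩ | ⟨rfl, rfl⟩
    · exact ⟨he, hf⟩
    · exact ⟨hf, he⟩
  have h3 := (mk_mem_edgePairs (hab.trans hbc)).2 ((graph_adj (hab.trans hbc)).2 (Or.inr h1))
  have h4 := (mk_mem_edgePairs (hbc.trans hcd)).2 ((graph_adj (hbc.trans hcd)).2 (Or.inr h2))
  exact h _ _ _ _ h3 h4 hab hbc hcd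

/-- The graph is contained in the edge set of some tree, and both have `2n - 3` edges: `(n - 3) + n`
on one side, `2(n - 1) - 1` on the other. -/
theorem exists_edges_eq_edgePairs {n : ℕ} (hn : 3 ≤ n) {D : Finset (Sym2 (Fin n))}
    (hD : IsTriangulation D) : ∃ t : BinaryTree Unit, t.numNodes = n - 2 ∧
      edges t 0 = edgePairs (graph D) := by
  obtain ⟨h1, h2, h3⟩ := hD
  obtain ⟨t, ht, hsub⟩ := exists_subset_edges (n - 1) 0 (by omega) (edgePairs (graph D))
    (fun u v h => by
      obtain ⟨hu, hv, huv, -⟩ := mem_edgePairs.1 h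
      omega) (noncrossing_edgePairs_graph h3)
  have hc := card_edges t 0
  have hc' := card_edgePairs_graph hn h2
  refine ⟨t, ?_, (eq_of_subset_of_card_le hsub (by omega)).symm⟩
  rw [numLeaves_eq_numNodes_succ] at ht
  omega

theorem exists_edgePairs_eq_edges {n : ℕ} (hn : 3 ≤ n) {t : BinaryTree Unit}
    (ht : t.numNodes = n - 2) : ∃ D : Finset (Sym2 (Fin n)), IsTriangulation D ∧
      edgePairs (graph D) = edges t 0 := by
  classical
  have hl : t.numLeaves = n - 1 := by
    rw [numLeaves_eq_numNodes_succ]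
    omega
  let D : Finset (Sym2 (Fin n)) := {e | IsDiagonal e ∧ toPair e ∈ edges t 0}
  have hdiag : ∀ e ∈ D, IsDiagonal e := fun e he => (mem_filter.1 he).2.1
  have heq : edgePairs (graph D) = edges t 0 := by
    rw [edgePairs_graph hn hdiag]
    ext ⟨u, v⟩
    rw [mem_union, mem_sidePairs hn, mem_image]
    constructor
    · rintro ((⟨rfl, h⟩ | ⟨rfl, h⟩) | ⟨e, he, h⟩)
      · exact side_mem_edges (by omega) (by omega)
      · obtain rfl : v = 0 + t.numLeaves := by omega
        exact base_mem_edges t 0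
      · exact h ▸ (mem_filter.1 he).2.2
    · intro h
      by_cases hs : (v = u + 1 ∧ v < n) ∨ (u = 0 ∧ v + 1 = n)
      · exact Or.inl hs
      · have hb := bounds_of_mem_edges h
        have hlt : (⟨u, by omega⟩ : Fin n) < ⟨v, by omega⟩ := hb.2.1
        refine Or.inr ⟨_, mem_filter.2 ⟨mem_univ _, ⟨?_, ?_⟩, ?_⟩, toPair_mk hlt⟩
        · rw [Sym2.mk_isDiag_iff]
          exact hlt.ne
        · rw [SimpleGraph.mem_edgeSet, cycleGraph_adj_of_lt hlt]
          dsimp only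
          omega
        · rw [toPair_mk hlt]
          exact h
  refine ⟨D, ⟨?_, hdiag, not_cross_of_noncrossing (heq ▸ noncrossing_edges t 0)⟩, heq⟩
  have hc := card_edges t 0
  have hc' := card_edgePairs_graph hn hdiag
  rw [heq] at hc'
  omega

/-- Triangulations and trees both map injectively to edge sets, with the same image. -/
theorem sum_triangulations {n : ℕ} (hn : 3 ≤ n) (F : Finset (ℕ × ℕ) → ℚ) :
    ∑ D ∈ triangulations n, F (edgePairs (graph D)) =
      ∑ t ∈ treesOfNumNodesEq (n - 2), F (edges t 0) := by
  classical
  have himage : (triangulations n).image (fun D => edgePairs (graph D)) =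
      (treesOfNumNodesEq (n - 2)).image (edges · 0) := by
    ext E
    simp only [triangulations, mem_image, mem_filter, mem_univ, true_and, mem_treesOfNumNodesEq]
    constructor
    · rintro ⟨D, hD, rfl⟩
      exact exists_edges_eq_edgePairs hn hD
    · rintro ⟨t, ht, rfl⟩
      exact exists_edgePairs_eq_edges hn ht
  rw [← sum_image (f := F) (g := fun D => edgePairs (graph D)), himage,
    sum_image fun t _ t' _ h => edges_injective h]
  intro D hD D' hD' h
  simp only [triangulations, coe_filter, mem_univ, true_and, Set.mem_ofPred_eq] at hD hD'
  exact (subset_of_edgePairs_graph_subset hD.2.1 h.le).antisymm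
    (subset_of_edgePairs_graph_subset hD'.2.1 h.ge)

theorem card_triangulations {n : ℕ} (hn : 3 ≤ n) :
    (#(triangulations n) : ℚ) = catalan (n - 2) := by
  have := sum_triangulations hn fun _ => 1
  simpa [treesOfNumNodesEq_card_eq_catalan] using this

end PolygonDissection

/-! ### Cycles in a noncrossing graph follow the cyclic order -/

namespace PolygonDissection

open Finset BinaryTree

section CyclicallyConsecutive

variable {n k : ℕ}

/-- `u < v` are neighbours in the cyclic order on the set `S`. -/
def CyclicallyConsecutive (S : Finset (Fin n)) (u v : Fin n) : Prop :=
  u ∈ S ∧ v ∈ S ∧ u < v ∧ ((∀ x ∈ S, x ≤ u ∨ v ≤ x) ∨ ∀ x ∈ S, u ≤ x ∧ x ≤ v)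

theorem cyclicallyConsecutive_orderIso (hk : 3 ≤ k) {S : Finset (Fin n)} (e : Fin k ≃o S)
    {a b : Fin k} (hab : a < b) :
    CyclicallyConsecutive S (e a) (e b) ↔ (SimpleGraph.cycleGraph k).Adj a b := by
  have hall : ∀ {P : Fin n → Prop}, (∀ x ∈ S, P x) ↔ ∀ c, P (e c) := fun {P} =>
    ⟨fun h c => h _ (e c).2, fun h x hx => by simpa using h (e.symm ⟨x, hx⟩)⟩
  have hle : ∀ {c d : Fin k}, (e c : Fin n) ≤ e d ↔ c ≤ d := fun {c d} => by
    rw [Subtype.coe_le_coe, e.le_iff_le]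
  have hlt : (e a : Fin n) < e b := by
    rw [Subtype.coe_lt_coe, e.lt_iff_lt]
    exact hab
  simp only [CyclicallyConsecutive, (e a).2, (e b).2, hlt, true_and, hall, hle]
  rw [cycleGraph_adj_of_lt hab]
  simp only [Fin.le_def, Fin.lt_def] at hab ⊢
  constructor
  · rintro (h | h)
    · have := h ⟨a + 1, by omega⟩
      dsimp only at this
      omega
    · have h0 := h ⟨0, by omega⟩
      have h1 := h ⟨k - 1, by omega⟩
      dsimp only at h0 h1
      omega
  · rintro (h | h)
    · left
      intro c
      omega
    · right
      intro c
      omega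

open scoped Fin.NatCast in
/-- In a noncrossing graph, an edge of a cycle does not separate the other vertices. -/
theorem between_iff_between {G : SimpleGraph (Fin n)} (hG : Noncrossing (edgePairs G))
    {f : Fin (k + 2) → Fin n} (hf : Function.Injective f)
    (hadj : ∀ a, G.Adj (f a) (f (a + 1))) {u v : Fin n} (huv : u < v) (p : Fin (k + 2))
    (hp : (f p = u ∧ f (p + 1) = v) ∨ (f p = v ∧ f (p + 1) = u)) {c d : Fin (k + 2)}
    (hcu : f c ≠ u) (hcv : f c ≠ v) (hdu : f d ≠ u) (hdv : f d ≠ v) :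
    (u < f c ∧ f c < v) → (u < f d ∧ f d < v) := by
  have hGuv : G.Adj u v := by
    rcases hp with ⟨rfl, rfl⟩ | ⟨rfl, rfl⟩
    · exact hadj p
    · exact (hadj p).symm
  -- An edge leaving the open interval between `u` and `v` elsewhere than at its ends would cross
  -- `uv`.
  have step : ∀ {x y : Fin n}, G.Adj x y → y ≠ u → y ≠ v → (u < x ∧ x < v) →
      (u < y ∧ y < v) := by
    rintro x y hxy hyu hyv ⟨h1, h2⟩
    by_contra hcon
    rcases lt_or_gt_of_ne hyu with h | h
    · exact hG _ _ _ _ ((mk_mem_edgePairs (h.trans h1)).2 hxy.symm)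
        ((mk_mem_edgePairs huv).2 hGuv) h h1 h2
    · have h3 : v < y := lt_of_le_of_ne (not_lt.1 fun h' => hcon ⟨h, h'⟩) hyv.symm
      exact hG _ _ _ _ ((mk_mem_edgePairs huv).2 hGuv)
        ((mk_mem_edgePairs (h2.trans h3)).2 hxy) h1 h2 h3
  -- Deleting `u` and `v` leaves the path at positions `p + 2, …, p + k + 1`, along which the side
  -- of `uv` cannot change.
  have hne : ∀ j : ℕ, 2 ≤ j → j < k + 2 → f (p + (j : Fin (k + 2))) ≠ u ∧
      f (p + (j : Fin (k + 2))) ≠ v := by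
    intro j hj hjk
    have h0 : f (p + (j : Fin (k + 2))) ≠ f p := fun h => by
      have := congrArg Fin.val (add_eq_left.1 (hf h))
      rw [Fin.val_natCast, Nat.mod_eq_of_lt hjk] at this
      simp at this
      omega
    have h1 : f (p + (j : Fin (k + 2))) ≠ f (p + 1) := fun h => by
      have := congrArg Fin.val (add_left_cancel (hf h))
      rw [Fin.val_natCast, Nat.mod_eq_of_lt hjk, Fin.val_one] at this
      omega
    rcases hp with ⟨rfl, rfl⟩ | ⟨rfl, rfl⟩
    · exact ⟨h0, h1⟩
    · exact ⟨h1, h0⟩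
  have hstep : ∀ j : ℕ, 2 ≤ j → j + 1 < k + 2 →
      ((u < f (p + (j : Fin (k + 2))) ∧ f (p + (j : Fin (k + 2))) < v) ↔
      (u < f (p + ((j + 1 : ℕ) : Fin (k + 2))) ∧ f (p + ((j + 1 : ℕ) : Fin (k + 2))) < v)) := by
    intro j hj hjk
    have h1 := hne j hj (by omega)
    have h2 := hne (j + 1) (by omega) hjk
    have ha := hadj (p + (j : Fin (k + 2)))
    rw [add_assoc, ← Nat.cast_succ] at ha
    exact ⟨step ha h2.1 h2.2, step ha.symm h1.1 h1.2⟩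
  have hall : ∀ j : ℕ, 2 ≤ j → j < k + 2 →
      ((u < f (p + (j : Fin (k + 2))) ∧ f (p + (j : Fin (k + 2))) < v) ↔
      (u < f (p + ((2 : ℕ) : Fin (k + 2))) ∧ f (p + ((2 : ℕ) : Fin (k + 2))) < v)) := by
    intro j hj
    induction j, hj using Nat.le_induction with
    | base => exact fun _ => Iff.rfl
    | succ j hj ih => exact fun h => (hstep j hj h).symm.trans (ih (by omega))
  have hpos : ∀ z : Fin (k + 2), f z ≠ u → f z ≠ v →
      ((u < f z ∧ f z < v) ↔
      (u < f (p + ((2 : ℕ) : Fin (k + 2))) ∧ f (p + ((2 : ℕ) : Fin (k + 2))) < v)) := by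
    intro z hzu hzv
    have hz : z = p + (((z - p).val : ℕ) : Fin (k + 2)) := by
      rw [Fin.cast_val_eq_self, add_sub_cancel]
    rw [hz]
    refine hall _ ?_ (z - p).2
    have hz0 : z ≠ p := by
      rintro rfl
      rcases hp with ⟨h, -⟩ | ⟨h, -⟩
      · exact hzu h
      · exact hzv h
    have hz1 : z ≠ p + 1 := by
      rintro rfl
      rcases hp with ⟨-, h⟩ | ⟨-, h⟩
      · exact hzv h
      · exact hzu h
    by_contra hlt
    have h01 : (z - p).val = 0 ∨ (z - p).val = 1 := by omega
    rcases h01 with h | h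
    · rw [h] at hz
      simp at hz
      exact hz0 hz
    · rw [h] at hz
      simp at hz
      exact hz1 hz
  rw [hpos c hcu hcv, hpos d hdu hdv]
  exact id

theorem cyclicallyConsecutive_of_adj {G : SimpleGraph (Fin n)} (hG : Noncrossing (edgePairs G))
    (hk : 3 ≤ k) {f : Fin k → Fin n} (hf : Function.Injective f)
    (hadj : ∀ a b, (SimpleGraph.cycleGraph k).Adj a b → G.Adj (f a) (f b))
    {a b : Fin k} (hab : (SimpleGraph.cycleGraph k).Adj a b) (hlt : f a < f b) :
    CyclicallyConsecutive (univ.image f) (f a) (f b) := by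
  obtain ⟨k, rfl⟩ : ∃ l, k = l + 2 := ⟨k - 2, by omega⟩
  refine ⟨mem_image_of_mem _ (mem_univ _), mem_image_of_mem _ (mem_univ _), hlt, ?_⟩
  have hadj' : ∀ a, G.Adj (f a) (f (a + 1)) := fun a => hadj _ _ (by
    rw [SimpleGraph.cycleGraph_adj]
    right
    rw [add_sub_cancel_left])
  obtain ⟨p, hp⟩ : ∃ p, (f p = f a ∧ f (p + 1) = f b) ∨ (f p = f b ∧ f (p + 1) = f a) := by
    rw [SimpleGraph.cycleGraph_adj] at hab
    rcases hab with h | h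
    · exact ⟨b, Or.inr ⟨rfl, by rw [← h, add_sub_cancel]⟩⟩
    · exact ⟨a, Or.inl ⟨rfl, by rw [← h, add_sub_cancel]⟩⟩
  by_contra hcon
  push Not at hcon
  obtain ⟨⟨x, hx, hx1, hx2⟩, y, hy, hy'⟩ := hcon
  obtain ⟨c, -, rfl⟩ := mem_image.1 hx
  obtain ⟨d, -, rfl⟩ := mem_image.1 hy
  have hda : f d ≠ f a := fun h => absurd (hy' h.ge) (not_lt.2 (h.trans_le hlt.le))
  have hdb : f d ≠ f b := fun h => absurd (hy' (hlt.le.trans h.ge)) (not_lt.2 h.le)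
  have h := between_iff_between hG hf hadj' hlt p hp hx1.ne' hx2.ne hda hdb ⟨hx1, hx2⟩
  exact absurd (hy' h.1.le) (not_lt.2 h.2.le)

/-- The induced injection of the finite set of adjacent pairs into itself is surjective. -/
theorem adj_of_adj_of_bijective {V : Type*} [Finite V] {G : SimpleGraph V} (σ : Equiv.Perm V)
    (hσ : ∀ a b, G.Adj a b → G.Adj (σ a) (σ b)) {a b : V} (h : G.Adj (σ a) (σ b)) :
    G.Adj a b := by
  let F : {p : V × V // G.Adj p.1 p.2} → {p : V × V // G.Adj p.1 p.2} :=
    fun p => ⟨(σ p.1.1, σ p.1.2), hσ _ _ p.2⟩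
  have hF : Function.Injective F := by
    rintro ⟨⟨a, b⟩, h⟩ ⟨⟨c, d⟩, h'⟩ heq
    simpa [F] using heq
  obtain ⟨⟨⟨c, d⟩, h'⟩, hcd⟩ := Finite.surjective_of_injective hF ⟨(σ a, σ b), h⟩
  simp only [F, Subtype.mk.injEq, Prod.mk.injEq, EmbeddingLike.apply_eq_iff_eq] at hcd
  obtain ⟨rfl, rfl⟩ := hcd
  exact h'

/-- Comparing the order along the cycle with the sorted order of `S` gives a permutation `σ` of `Fin
k`. Noncrossing makes `σ` preserve adjacency in the cycle graph, and finiteness makes it reflect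
adjacency. -/
theorem subgraph_adj_iff {G : SimpleGraph (Fin n)} (hG : Noncrossing (edgePairs G)) (hk : 3 ≤ k)
    {H : G.Subgraph} (φ : SimpleGraph.cycleGraph k ≃g H.coe) {S : Finset (Fin n)}
    (hS : (S : Set (Fin n)) = H.verts) {u v : Fin n} (huv : u < v) :
    H.Adj u v ↔ CyclicallyConsecutive S u v := by
  have hmem : ∀ x, x ∈ S ↔ x ∈ H.verts := fun x => by rw [← hS, mem_coe]
  let f : Fin k → Fin n := fun a => φ a
  have hf : Function.Injective f := Subtype.val_injective.comp φ.injective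
  have hrange : univ.image f = S := by
    ext x
    rw [hmem, mem_image]
    constructor
    · rintro ⟨a, -, rfl⟩
      exact (φ a).2
    · intro hx
      exact ⟨φ.symm ⟨x, hx⟩, mem_univ _, by simp [f]⟩
  have hHadj : ∀ a b, (SimpleGraph.cycleGraph k).Adj a b ↔ H.Adj (f a) (f b) := fun a b =>
    φ.map_adj_iff.symm
  have hfadj : ∀ a b, (SimpleGraph.cycleGraph k).Adj a b → G.Adj (f a) (f b) := fun a b h =>
    ((hHadj a b).1 h).adj_sub
  have hcard : #S = k := by
    rw [← hrange, card_image_of_injective _ hf, card_univ, Fintype.card_fin]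
  let e : Fin k ≃o S := S.orderIsoOfFin hcard
  have hfS : ∀ a, f a ∈ S := fun a => hrange ▸ mem_image_of_mem _ (mem_univ a)
  let σ : Equiv.Perm (Fin k) := Equiv.ofBijective (fun a => e.symm ⟨f a, hfS a⟩)
    (Finite.injective_iff_bijective.1 fun a b h => hf (by simpa using h))
  have hσ : ∀ a, (e (σ a) : Fin n) = f a := fun a => by simp [σ]
  have hlt : ∀ {a b}, f a < f b → σ a < σ b := fun {a b} h => by
    rw [← e.lt_iff_lt, ← Subtype.coe_lt_coe, hσ, hσ]
    exact h
  have hpres : ∀ a b, (SimpleGraph.cycleGraph k).Adj a b →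
      (SimpleGraph.cycleGraph k).Adj (σ a) (σ b) := by
    have key : ∀ a b, (SimpleGraph.cycleGraph k).Adj a b → f a < f b →
        (SimpleGraph.cycleGraph k).Adj (σ a) (σ b) := fun a b h h' => by
      rw [← cyclicallyConsecutive_orderIso hk e (hlt h'), hσ, hσ, ← hrange]
      exact cyclicallyConsecutive_of_adj hG hk hf hfadj h h'
    intro a b h
    rcases lt_or_gt_of_ne (hfadj a b h).ne with h' | h'
    · exact key a b h h'
    · exact (key b a h.symm h').symm
  have main : ∀ a b, f a < f b → (H.Adj (f a) (f b) ↔ CyclicallyConsecutive S (f a) (f b)) := by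
    intro a b hab
    rw [← hHadj, ← hσ a, ← hσ b, cyclicallyConsecutive_orderIso hk e (hlt hab)]
    exact ⟨hpres a b, adj_of_adj_of_bijective σ hpres⟩
  constructor
  · intro h
    obtain ⟨a, -, rfl⟩ := mem_image.1 (hrange ▸ (hmem u).2 h.fst_mem)
    obtain ⟨b, -, rfl⟩ := mem_image.1 (hrange ▸ (hmem v).2 h.snd_mem)
    exact (main a b huv).1 h
  · intro h
    obtain ⟨a, -, rfl⟩ := mem_image.1 (hrange ▸ h.1)
    obtain ⟨b, -, rfl⟩ := mem_image.1 (hrange ▸ h.2.1)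
    exact (main a b huv).2 h

/-- The polygon on a set of vertices of a graph, provided its sides are edges of the graph. -/
def polygonSubgraph (G : SimpleGraph (Fin n)) (S : Finset (Fin n))
    (hS : ∀ u v, CyclicallyConsecutive S u v → G.Adj u v) : G.Subgraph where
  verts := S
  Adj u v := CyclicallyConsecutive S u v ∨ CyclicallyConsecutive S v u
  adj_sub := by
    rintro u v (h | h)
    · exact hS _ _ h
    · exact (hS _ _ h).symm
  edge_vert := by
    rintro u v (h | h)
    · exact h.1
    · exact h.2.1
  symm := ⟨fun _ _ h => h.symm⟩

theorem nonempty_iso_polygonSubgraph (hk : 3 ≤ k) {G : SimpleGraph (Fin n)} {S : Finset (Fin n)}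
    (hcard : #S = k) (hS : ∀ u v, CyclicallyConsecutive S u v → G.Adj u v) :
    Nonempty (SimpleGraph.cycleGraph k ≃g (polygonSubgraph G S hS).coe) := by
  let e : Fin k ≃o S := S.orderIsoOfFin hcard
  have key : ∀ a b, a < b → ((CyclicallyConsecutive S (e a) (e b) ∨
      CyclicallyConsecutive S (e b) (e a)) ↔ (SimpleGraph.cycleGraph k).Adj a b) := by
    intro a b hab
    rw [cyclicallyConsecutive_orderIso hk e hab, or_iff_left]
    intro h
    have h1 : e b < e a := h.2.2.1
    exact absurd (e.lt_iff_lt.1 h1) hab.not_gt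
  refine ⟨⟨e.toEquiv, @fun a b => ?_⟩⟩
  change (CyclicallyConsecutive S (e a) (e b) ∨ CyclicallyConsecutive S (e b) (e a)) ↔ _
  rcases lt_trichotomy a b with h | rfl | h
  · exact key a b h
  · refine iff_of_false ?_ (SimpleGraph.irrefl _)
    rintro (h | h) <;> exact lt_irrefl _ h.2.2.1
  · rw [or_comm, SimpleGraph.adj_comm]
    exact key b a h

open Classical in
theorem numCycles_eq_card {G : SimpleGraph (Fin n)} (hG : Noncrossing (edgePairs G))
    (hk : 3 ≤ k) : numCycles G k =
      #{S : Finset (Fin n) | #S = k ∧ ∀ u v, CyclicallyConsecutive S u v → G.Adj u v} := by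
  have hverts : ∀ H : G.Subgraph, ((univ.filter (· ∈ H.verts) : Finset (Fin n)) : Set (Fin n)) =
      H.verts := fun H => by
    ext x
    rw [mem_coe, mem_filter, and_iff_right (mem_univ x)]
  rw [numCycles, SimpleGraph.copyCount]
  refine card_bij (fun H _ => univ.filter (· ∈ H.verts)) ?_ ?_ ?_
  · intro H hH
    obtain ⟨φ⟩ := (mem_filter.1 hH).2
    refine mem_filter.2 ⟨mem_univ _, ?_, fun u v h => ?_⟩
    · rw [← Fintype.card_subtype, ← Fintype.card_fin k]
      exact Fintype.card_congr φ.toEquiv.symm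
    · exact ((subgraph_adj_iff hG hk φ (hverts H) h.2.2.1).2 h).adj_sub
  · intro H hH H' hH' heq
    obtain ⟨φ⟩ := (mem_filter.1 hH).2
    obtain ⟨φ'⟩ := (mem_filter.1 hH').2
    have hlt : ∀ u v, u < v → (H.Adj u v ↔ H'.Adj u v) := fun u v h => by
      rw [subgraph_adj_iff hG hk φ (hverts H) h, heq, subgraph_adj_iff hG hk φ' (hverts H') h]
    refine SimpleGraph.Subgraph.ext (by rw [← hverts H, heq, hverts H']) ?_
    funext u v
    apply propext
    rcases lt_trichotomy u v with h | rfl | h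
    · exact hlt u v h
    · exact iff_of_false (fun h => h.ne rfl) (fun h => h.ne rfl)
    · rw [H.adj_comm, H'.adj_comm]
      exact hlt v u h
  · intro S hS
    obtain ⟨-, hcard, hadj⟩ := mem_filter.1 hS
    obtain ⟨H, hH, hiso⟩ : ∃ H : G.Subgraph, H.verts = S ∧
        Nonempty (SimpleGraph.cycleGraph k ≃g H.coe) :=
      ⟨polygonSubgraph G S hadj, rfl, nonempty_iso_polygonSubgraph hk hcard hadj⟩
    refine ⟨H, mem_filter.2 ⟨@mem_univ _ (_) H, hiso⟩, ?_⟩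
    rw [← coe_inj, hverts, hH]

end CyclicallyConsecutive

theorem isCycleIn_map_iff {n : ℕ} {G : SimpleGraph (Fin n)} {S : Finset (Fin n)} :
    IsCycleIn (edgePairs G) (S.map Fin.valEmbedding) ↔
      ∀ u v, CyclicallyConsecutive S u v → G.Adj u v := by
  simp only [IsCycleIn, IsPathIn, forall_mem_map, Fin.valEmbedding_apply, Fin.val_fin_lt,
    Fin.val_fin_le]
  constructor
  · rintro ⟨h1, h2⟩ u v ⟨hu, hv, huv, h | h⟩
    · exact (mk_mem_edgePairs huv).1 (h1 u hu v hv huv h)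
    · exact (mk_mem_edgePairs huv).1 (h2 u hu v hv huv h)
  · exact fun h => ⟨fun u hu v hv huv h' => (mk_mem_edgePairs huv).2
      (h u v ⟨hu, hv, huv, Or.inl h'⟩), fun u hu v hv huv h' => (mk_mem_edgePairs huv).2
      (h u v ⟨hu, hv, huv, Or.inr h'⟩)⟩

theorem numCycles_eq_cycleCount {n k : ℕ} (hn : 3 ≤ n) (hk : 3 ≤ k) {G : SimpleGraph (Fin n)}
    {t : BinaryTree Unit} (ht : t.numNodes = n - 2) (hG : edgePairs G = edges t 0) :
    numCycles G k = cycleCount t (k - 1) := by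
  classical
  have hl : t.numLeaves = n - 1 := by
    rw [numLeaves_eq_numNodes_succ]
    omega
  rw [numCycles_eq_card (hG ▸ noncrossing_edges t 0) hk, ← card_filter_cycleSets t 0,
    ← card_map (mapEmbedding Fin.valEmbedding).toEmbedding]
  congr 1
  ext S
  simp only [mem_map, mem_filter, mem_univ, true_and, RelEmbedding.coe_toEmbedding,
    mapEmbedding_apply, mem_cycleSets]
  constructor
  · rintro ⟨T, ⟨hT, hadj⟩, rfl⟩
    refine ⟨⟨?_, fun x hx => ?_, hG ▸ isCycleIn_map_iff.2 hadj⟩, ?_⟩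
    · rw [card_map]
      omega
    · obtain ⟨y, -, rfl⟩ := mem_map.1 hx
      have := y.2
      rw [Fin.valEmbedding_apply]
      omega
    · rw [card_map]
      omega
  · rintro ⟨⟨-, hb, hc⟩, hS⟩
    have hlt : ∀ x ∈ S, x < n := fun x hx => by
      have := hb x hx
      omega
    have hmap : (S.attachFin hlt).map Fin.valEmbedding = S := by
      ext x
      simp only [mem_map, mem_attachFin, Fin.valEmbedding_apply]
      exact ⟨by rintro ⟨y, hy, rfl⟩; exact hy, fun hx => ⟨⟨x, hlt x hx⟩, hx, rfl⟩⟩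
    refine ⟨S.attachFin hlt, ⟨?_, ?_⟩, hmap⟩
    · rw [card_attachFin]
      omega
    · rw [← isCycleIn_map_iff, hmap, hG]
      exact hc

theorem sum_numCycles {n k : ℕ} (hn : 3 ≤ n) (hk : 3 ≤ k) :
    ∑ D ∈ triangulations n, (numCycles (graph D) k : ℚ) =
      ∑ t ∈ treesOfNumNodesEq (n - 2), (cycleCount t (k - 1) : ℚ) := by
  classical
  -- The cycle count as a function of the edge set alone. By injectivity the choice of tree is
  -- immaterial, and the value 0 is never attained by default in the sum.
  let F : Finset (ℕ × ℕ) → ℚ := fun E =>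
    if h : ∃ t : BinaryTree Unit, edges t 0 = E then cycleCount h.choose (k - 1) else 0
  have hF : ∀ t, F (edges t 0) = cycleCount t (k - 1) := fun t => by
    have h : ∃ t' : BinaryTree Unit, edges t' 0 = edges t 0 := ⟨t, rfl⟩
    rw [show F (edges t 0) = cycleCount h.choose (k - 1) from dif_pos h,
      edges_injective h.choose_spec]
  rw [← sum_congr rfl fun t _ => hF t, ← sum_triangulations hn F]
  refine sum_congr rfl fun D hD => ?_
  obtain ⟨t, ht, heq⟩ := exists_edges_eq_edgePairs hn (mem_filter.1 hD).2
  rw [← heq, hF, numCycles_eq_cycleCount hn hk ht heq.symm]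

end PolygonDissection

theorem mainTheorem3 (n k : ℕ) (hk : 3 ≤ k) (hkn : k < n) :
    PolygonDissection.averageCycles n k =
      ((2 * n - k - 1).choose (n - 1) : ℚ) * ((catalan (k - 2) : ℚ) / (catalan (n - 2) : ℚ)) := by
  rw [PolygonDissection.averageCycles, PolygonDissection.sum_numCycles (by omega) hk,
    PolygonDissection.card_triangulations (by omega), PolygonDissection.sum_cycleCount n k hk hkn,
    mul_div_assoc]
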